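/- Let $K$ be a number field, let $m \ge 0$, let $q, \xi, \alpha_1, \dots, \alpha_m \in K^*$ be nonzero and let $\beta_0, \beta_1, \dots, \beta_m \in K$. Assume that $|q|_v \neq 1$ for every archimedean place $v$ of $K$, and that the classes of $\alpha_1, \dots, \alpha_m$ in $K^*/q^{\mathbb{Z}}$ are pairwise distinct. Put $n_q = \frac{1-q^n}{1-q}$ and $n_q! = \prod_{k=1}^n k_q$. For a place $v$ of $K$ with completion $K_v$ such that $|q|_v > 1$, let $E_q(z) = \sum_{n \ge 0} \frac{z^n}{n_q!}$ be the $q$-exponential, viewed as an everywhere convergent power series on $K_v$. Suppose that for every place $v$ of $K$ (archimedean or not) such that $|q|_v > 1$, the $v$-adic function $$\beta_0 + \beta_1 E_q(\alpha_1 z) + \dots + \beta_m E_q(\alpha_m z)$$ vanishes at $z = \xi$. Then $\beta_0 = 0$ and, for every place $v$ of $K$ such that $|q|_v > 1$ and every $i \in \{1, \dots, m\}$, one has $\beta_i E_q(\alpha_i \xi) = 0$ in $K_v$. -/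

import Mathlib

/-- The `q`-integer `n_q = (1 - q ^ n) / (1 - q)` (used for `q ≠ 1`). -/
noncomputable def qInt {L : Type*} [Field L] (q : L) (n : ℕ) : L :=
  (1 - q ^ n) / (1 - q)

/-- The `q`-factorial `n_q! = ∏_{m = 1}^{n} m_q`. -/
noncomputable def qFact {L : Type*} [Field L] (q : L) (n : ℕ) : L :=
  ∏ m ∈ Finset.Icc 1 n, qInt q m

/-- The value at `z` of the `q`-exponential `E_q(z) = ∑_{n ≥ 0} z ^ n / n_q!`.
The series converges for every `z` if `L` is complete and `‖q‖ > 1`: see `summable_qExp`. -/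
noncomputable def qExp {L : Type*} [NormedField L] (q z : L) : L :=
  ∑' n : ℕ, z ^ n / qFact q n

theorem tendsto_norm_qInt {L : Type*} [NormedField L] {q : L} (hq : 1 < ‖q‖) :
    Filter.Tendsto (fun n => ‖qInt q n‖) Filter.atTop Filter.atTop := by
  have h1 : q ≠ 1 := by rintro rfl; simp at hq
  have h2 : 0 < ‖1 - q‖ := norm_pos_iff.mpr (sub_ne_zero.mpr h1.symm)
  have h3 : Filter.Tendsto (fun n : ℕ => (‖q‖ ^ n - 1) / ‖1 - q‖) Filter.atTop Filter.atTop :=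
    (Filter.tendsto_atTop_add_const_right _ (-1) (tendsto_pow_atTop_atTop_of_one_lt hq)).atTop_div_const h2
  refine Filter.tendsto_atTop_mono (fun n => ?_) h3
  rw [qInt, norm_div]
  gcongr
  have := norm_sub_norm_le (q ^ n) 1
  rw [norm_pow, norm_one, norm_sub_rev] at this
  exact this

/-- For `‖q‖ > 1` the series defining the `q`-exponential converges everywhere. -/
theorem summable_qExp {L : Type*} [NormedField L] [CompleteSpace L] {q : L} (hq : 1 < ‖q‖)
    (z : L) : Summable fun n : ℕ => z ^ n / qFact q n := by
  have h := (tendsto_norm_qInt hq).comp (Filter.tendsto_add_atTop_nat 1)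
  refine summable_of_ratio_norm_eventually_le (r := 1 / 2) (by norm_num) ?_
  filter_upwards [h.eventually_ge_atTop (2 * ‖z‖ + 1)] with n hn
  simp only [Function.comp] at hn
  have hpos : 0 < ‖qInt q (n + 1)‖ := lt_of_lt_of_le (by positivity) hn
  have e : z ^ (n + 1) / qFact q (n + 1) = z / qInt q (n + 1) * (z ^ n / qFact q n) := by
    rw [qFact, Finset.prod_Icc_succ_top (by omega), ← qFact, pow_succ]
    rw [div_mul_div_comm, mul_comm z, mul_comm (qFact q n)]
  rw [e, norm_mul, norm_div]
  refine mul_le_mul_of_nonneg_right ?_ (norm_nonneg _)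
  rw [div_le_iff₀ hpos]
  linarith

/-- The places of a number field `K`, each represented by its standard absolute value: the
archimedean ones (from complex embeddings) and the finite ones (from nonzero prime ideals). -/
def IsPlace {K : Type*} [Field K] [NumberField K] (v : AbsoluteValue K ℝ) : Prop :=
  NumberField.IsInfinitePlace v ∨ NumberField.IsFinitePlace v

/-- The canonical embedding of a field `K` into its completion `K_v`. -/
noncomputable def toCompletion {K : Type*} [Field K] (v : AbsoluteValue K ℝ) :
    K →+* v.Completion :=
  UniformSpace.Completion.coeRingHom.comp (WithAbs.equiv v).symm.toRingHom

/-- The `v`-adic norm on `K_v` extends the absolute value `v` of `K`. -/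
theorem norm_toCompletion {K : Type*} [Field K] (v : AbsoluteValue K ℝ) (x : K) :
    ‖toCompletion v x‖ = v x := by
  change ‖((WithAbs.toAbs v x : WithAbs v) : UniformSpace.Completion (WithAbs v))‖ = v x
  rw [UniformSpace.Completion.norm_coe]
  rfl

/-- The `v`-adic function `z ↦ β₀ + β₁ E_q(α₁ z) + ⋯ + β_m E_q(α_m z)` on `K_v`. -/
noncomputable def qExpSum {K : Type*} [Field K] (v : AbsoluteValue K ℝ) (q : K) {m : ℕ}
    (α : Fin m → K) (β₀ : K) (β : Fin m → K) (z : v.Completion) : v.Completion :=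
  toCompletion v β₀ +
    ∑ i, toCompletion v (β i) * qExp (toCompletion v q) (toCompletion v (α i) * z)

/-!
Write `F(z) = β₀ + ∑ β_i E_q(α_i z) = ∑ (a_n / n_q!) z ^ n` and let `h_n = n_q! g_n`, where
`F(z) / (z - ξ) = ∑ g_n z ^ n`. The sequence `h` satisfies the first-order recurrence
`ξ h_n = n_q h_{n-1} - a_n`, with `a_n = ∑ β_i α_i ^ n` for `n ≥ 1`.

At every place `v` the growth of `h` is at most geometric. If `|q|_v ≤ 1`, the `q`-integers are
bounded and the recurrence suffices (`growth_qQuotient_of_bounded`); if `|q|_v > 1`, the vanishing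
of `F` at `ξ` turns `h_n` into a rescaled tail of a rapidly convergent series
(`growth_qQuotient_of_vanish`). Moreover `h` is integral at almost all finite places.

With `σ` the shift, `D` the multiplication by `q ^ n` and `P = ∏ (X - α_i)`, put
`Q_N = ∏_{k = 1}^N P(q ^ k X)`, up to a constant the polynomial with the roots `q ^ (-k) α_i`,
`1 ≤ k ≤ N`. Because `σ D = q D σ` and `P(σ)` kills the inhomogeneous term of the recurrence,
`D Q_{N+1}(σ) h` is a fixed polynomial in `σ` applied to `Q_N(σ) h` (`seqScale_qIterate`). So where
`|q|_v > 1` the growth rate of `Q_N(σ) h` is that of `h` divided by `|q|_v ^ N`, while at the other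
places it does not increase. Since `|q|_v > 1` for at least one `v`, the product of the local rates
is less than `1` for large `N`, and the product formula forces `Q_N(σ) h` to vanish eventually
(`exists_qIterate_eventually_eq_zero`).

Hence `h_n` is, for large `n`, a combination of the `(q ^ (-k) α_i) ^ n`, which are pairwise distinct
geometric sequences by the hypothesis on the classes of the `α_i`. Substituting into the recurrence
gives, for each `i` with `β_i ≠ 0`, some `k ≥ 1` with `(1 - q) ξ α_i = q ^ k` (`exists_resonance`).
These points `α_i ξ = q ^ k / (1 - q)` are zeros of `E_q` at every place with `|q|_v > 1`, by the
functional equation `E_q(q z) = (1 + (q - 1) z) E_q(z)`. All the terms `β_i E_q(α_i ξ)` are therefore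
zero, and so is `β₀`.
-/

open Polynomial Filter Asymptotics Topology

/-! ### The shift and the `q`-scaling on sequences -/

section Sequences

variable {K : Type*} [Field K]

/-- The shift `(x_n) ↦ (x_{n+1})` on sequences. -/
def seqShift (K : Type*) [Field K] : Module.End K (ℕ → K) :=
  LinearMap.funLeft K K (· + 1)

/-- The operator `(x_n) ↦ (q ^ n x_n)` on sequences; on generating functions it is `f(z) ↦ f(qz)`. -/
def seqScale (q : K) : Module.End K (ℕ → K) where
  toFun x n := q ^ n * x n
  map_add' x y := by ext n; simp [mul_add]
  map_smul' c x := by ext n; simp [mul_left_comm]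

@[simp] theorem seqShift_apply (x : ℕ → K) (n : ℕ) : seqShift K x n = x (n + 1) := rfl

@[simp] theorem seqScale_apply (q : K) (x : ℕ → K) (n : ℕ) : seqScale q x n = q ^ n * x n := rfl

theorem seqShift_pow_apply (k : ℕ) (x : ℕ → K) (n : ℕ) : (seqShift K ^ k) x n = x (n + k) := by
  induction k generalizing n with
  | zero => simp
  | succ k ih => rw [pow_succ', Module.End.mul_apply, seqShift_apply, ih, add_right_comm]; rfl

theorem seqShift_mul_seqScale (q : K) :
    seqShift K * seqScale q = seqScale q * (q • seqShift K) := by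
  ext x n
  simp [pow_succ, mul_assoc, mul_left_comm]

theorem aeval_seqShift_seqScale (q : K) (P : K[X]) (x : ℕ → K) :
    aeval (seqShift K) P (seqScale q x) =
      seqScale q (aeval (seqShift K) (P.comp (C q * X)) x) := by
  have h : aeval (seqShift K) P * seqScale q = seqScale q * aeval (q • seqShift K) P := by
    induction P using Polynomial.induction_on' with
    | add P Q hP hQ => rw [map_add, map_add, add_mul, mul_add, hP, hQ]
    | monomial n a =>
      have hn : seqShift K ^ n * seqScale q = seqScale q * (q • seqShift K) ^ n := by
        induction n with
        | zero => simp
        | succ n ih => rw [pow_succ, mul_assoc, seqShift_mul_seqScale, ← mul_assoc, ih, mul_assoc,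
            ← pow_succ]
      simp only [aeval_monomial, mul_assoc, hn]
      rw [← mul_assoc, ← mul_assoc, Algebra.commutes a (seqScale q)]
  have e : aeval (seqShift K) (P.comp (C q * X)) = aeval (q • seqShift K) P := by
    rw [aeval_comp]; congr 2; simp [Algebra.smul_def]
  rw [e]
  exact LinearMap.congr_fun h x

theorem aeval_seqShift_geom (P : K[X]) (c l : K) :
    aeval (seqShift K) P (fun n => c * l ^ n) = fun n => P.eval l * (c * l ^ n) := by
  have h : Module.End.HasEigenvector (seqShift K) l (fun n => l ^ n) := by
    refine ⟨Module.End.mem_eigenspace_iff.mpr ?_, fun h => ?_⟩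
    · ext n; simp [pow_succ']
    · simpa using congr_fun h 0
  have e : (fun n => c * l ^ n) = c • (fun n : ℕ => l ^ n) := rfl
  rw [e, map_smul, Module.End.aeval_apply_of_hasEigenvector h]
  ext n
  simp [mul_left_comm]

theorem geom_linearIndependent {ι : Type*} (s : Finset ι) {l : ι → K} (hl : Function.Injective l)
    {e : ι → K} (h : ∀ n : ℕ, ∑ j ∈ s, e j * l j ^ n = 0) : ∀ j ∈ s, e j = 0 := by
  have hinj : Function.Injective fun j => powersHom K (l j) := (powersHom K).injective.comp hl
  have hli := (linearIndependent_monoidHom (Multiplicative ℕ) K).comp _ hinj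
  refine linearIndependent_iff'.mp hli s e ?_
  ext n
  simpa [Finset.sum_apply] using h n.toAdd

/-- A sequence annihilated by `∏ (σ - λ_j)`, with the `λ_j` distinct, is a combination of the
geometric sequences `λ_j ^ n`. -/
theorem exists_eq_sum_geom {ι : Type*} (s : Finset ι) {l : ι → K}
    (hl : Function.Injective l) (y : ℕ → K)
    (hy : aeval (seqShift K) (∏ j ∈ s, (X - C (l j))) y = 0) :
    ∃ c : ι → K, ∀ n, y n = ∑ j ∈ s, c j * l j ^ n := by
  classical
  induction s using Finset.induction_on generalizing y with
  | empty => exact ⟨0, fun n => by simpa using congr_fun hy n⟩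
  | insert a s ha ih =>
    rw [Finset.prod_insert ha, mul_comm, map_mul, Module.End.mul_apply] at hy
    obtain ⟨c, hc⟩ := ih _ hy
    have hc' : ∀ n, y (n + 1) - l a * y n = ∑ j ∈ s, c j * l j ^ n := fun n => by
      rw [← hc]; simp [Module.algebraMap_end_apply]
    have hne : ∀ j ∈ s, l j - l a ≠ 0 := fun j hj =>
      sub_ne_zero.mpr fun h => ha (hl h ▸ hj)
    let z : ℕ → K := fun n => y n - ∑ j ∈ s, c j / (l j - l a) * l j ^ n
    have hz : ∀ n, z (n + 1) = l a * z n := by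
      intro n
      have e : ∑ j ∈ s, c j / (l j - l a) * l j ^ (n + 1) -
          l a * ∑ j ∈ s, c j / (l j - l a) * l j ^ n = ∑ j ∈ s, c j * l j ^ n := by
        rw [Finset.mul_sum, ← Finset.sum_sub_distrib]
        refine Finset.sum_congr rfl fun j hj => ?_
        have := hne j hj
        field_simp
        ring
      have := hc' n
      simp only [z]
      linear_combination this - e
    have hz' : ∀ n, z n = z 0 * l a ^ n := by
      intro n
      induction n with
      | zero => simp
      | succ n ihn => rw [hz, ihn, pow_succ]; ring
    refine ⟨fun j => if j = a then z 0 else c j / (l j - l a), fun n => ?_⟩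
    have e : ∑ j ∈ s, (if j = a then z 0 else c j / (l j - l a)) * l j ^ n =
        ∑ j ∈ s, c j / (l j - l a) * l j ^ n :=
      Finset.sum_congr rfl fun j hj => by rw [if_neg (ne_of_mem_of_not_mem hj ha)]
    simp only [Finset.sum_insert ha, e, if_true, ← hz', z]
    ring

/-- The polynomials `Q_N = ∏_{k = 1}^N P(q ^ k X)`, defined by `Q_{N+1} = (P Q_N)(q X)`. -/
noncomputable def qIterate (q : K) (P : K[X]) : ℕ → K[X]
  | 0 => 1
  | N + 1 => (P * qIterate q P N).comp (C q * X)

/-- The roots of `Q_N` for `P = ∏ (X - α_i)` are the `q ^ (-k) α_i` with `1 ≤ k ≤ N`. -/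
theorem qIterate_prod_X_sub_C {m : ℕ} {q : K} (hq : q ≠ 0) (α : Fin m → K) (N : ℕ) :
    ∃ c : K, c ≠ 0 ∧ qIterate q (∏ i, (X - C (α i))) N =
      C c * ∏ k ∈ Finset.range N, ∏ i, (X - C (α i / q ^ (k + 1))) := by
  have hX : ∀ a : K, (X - C a).comp (C q * X) = C q * (X - C (a / q)) := by
    intro a
    rw [sub_comp, X_comp, C_comp, mul_sub, ← C_mul, mul_div_cancel₀ _ hq]
  have hP : ∀ f : Fin m → K, (∏ i, (X - C (f i))).comp (C q * X) =
      C (q ^ m) * ∏ i, (X - C (f i / q)) := by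
    intro f
    simp [Polynomial.prod_comp, hX, Finset.prod_mul_distrib]
  induction N with
  | zero => exact ⟨1, one_ne_zero, by simp [qIterate]⟩
  | succ N ih =>
    obtain ⟨c, hc, e⟩ := ih
    refine ⟨q ^ m * c * (q ^ m) ^ N, by positivity, ?_⟩
    rw [qIterate, e, mul_comp, mul_comp, C_comp, hP, Polynomial.prod_comp, Finset.prod_range_succ']
    simp only [hP, Finset.prod_mul_distrib, Finset.prod_const, Finset.card_range, C_mul, zero_add,
      pow_one, div_div, ← pow_succ, C_pow]
    ring

/-- If `q D h = R(σ) h - b` and `P(σ) b = 0`, then `D` carries `Q_{N+1}(σ) h` to a fixed polynomial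
in `σ` applied to `Q_N(σ) h`, where `D` is multiplication by `q ^ n`. -/
theorem seqScale_qIterate {q : K} (hq : q ≠ 0) {P R : K[X]} {h b : ℕ → K}
    (hrec : q • seqScale q h = aeval (seqShift K) R h - b)
    (hb : aeval (seqShift K) P b = 0) (N : ℕ) :
    seqScale q (aeval (seqShift K) (qIterate q P (N + 1)) h) =
      aeval (seqShift K) (C q⁻¹ * P * R) (aeval (seqShift K) (qIterate q P N) h) := by
  have h1 : seqScale q h = q⁻¹ • (aeval (seqShift K) R h - b) := by
    rw [← hrec, smul_smul, inv_mul_cancel₀ hq, one_smul]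
  have h2 : aeval (seqShift K) (P * qIterate q P N) b = 0 := by
    rw [mul_comm, map_mul, Module.End.mul_apply, hb, map_zero]
  rw [qIterate, ← aeval_seqShift_seqScale, h1, map_smul, map_sub, h2, sub_zero,
    ← Module.End.mul_apply, ← Module.End.mul_apply, ← map_mul, ← map_mul, ← LinearMap.smul_apply,
    ← map_smul, smul_eq_C_mul]
  congr 2
  ring

end Sequences

/-! ### Growth of sequences at one place -/

section Growth

variable {K : Type*} [Field K] {v : AbsoluteValue K ℝ}

theorem growth_aeval_seqShift {r : ℝ} {x : ℕ → K}
    (hx : (fun n => v (x n)) =O[atTop] fun n => r ^ n) (P : K[X]) :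
    (fun n => v (aeval (seqShift K) P x n)) =O[atTop] fun n => r ^ n := by
  have hadd : ∀ {y z : ℕ → K}, (fun n => v (y n)) =O[atTop] (fun n => r ^ n) →
      (fun n => v (z n)) =O[atTop] (fun n => r ^ n) →
      (fun n => v ((y + z) n)) =O[atTop] (fun n => r ^ n) := fun {y z} hy hz => by
    refine (IsBigO.of_norm_le fun n => ?_ : _ =O[atTop] fun n => v (y n) + v (z n)).trans
      (hy.add hz)
    simpa [abs_of_nonneg (v.nonneg _)] using v.add_le (y n) (z n)
  have hshift : ∀ {y : ℕ → K}, (fun n => v (y n)) =O[atTop] (fun n => r ^ n) →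
      (fun n => v (seqShift K y n)) =O[atTop] (fun n => r ^ n) := fun {y} hy => by
    refine (hy.comp_tendsto (tendsto_add_atTop_nat 1)).trans ?_
    have : ((fun n => r ^ n) ∘ fun n => n + 1) = fun n : ℕ => r * r ^ n := by
      ext n; simp [pow_succ']
    rw [this]
    exact isBigO_const_mul_self r _ _
  induction P using Polynomial.induction_on' with
  | add P Q hP hQ => rw [map_add, LinearMap.add_apply]; exact hadd hP hQ
  | monomial n a =>
    have hn : (fun k => v ((seqShift K ^ n) x k)) =O[atTop] (fun k => r ^ k) := by
      induction n with
      | zero => simpa using hx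
      | succ n ih => rw [pow_succ', Module.End.mul_apply]; exact hshift ih
    simp only [aeval_monomial, Module.End.mul_apply, Module.algebraMap_end_apply, Pi.smul_apply,
      smul_eq_mul, map_mul]
    exact hn.const_mul_left _

theorem growth_of_seqScale {q : K} (hq : q ≠ 0) {r : ℝ} {x : ℕ → K}
    (hx : (fun n => v (seqScale q x n)) =O[atTop] fun n => r ^ n) :
    (fun n => v (x n)) =O[atTop] fun n => (r / v q) ^ n := by
  have h := (isBigO_refl (fun n : ℕ => (v q ^ n)⁻¹) atTop).mul hx
  have hv : v q ≠ 0 := v.ne_zero hq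
  refine (h.congr (fun n => ?_) fun n => ?_)
  · simp [hv]
  · rw [div_pow, div_eq_inv_mul]

/-- At a place where `|q|_v > 1` each of the `N` steps of `Q_N` divides the growth rate by
`|q|_v`; at the other places the rate is unchanged. -/
theorem growth_qIterate {q : K} (hq : q ≠ 0) {P R : K[X]} {h b : ℕ → K}
    (hrec : q • seqScale q h = aeval (seqShift K) R h - b)
    (hb : aeval (seqShift K) P b = 0) {r : ℝ}
    (hh : (fun n => v (h n)) =O[atTop] fun n => r ^ n) (N : ℕ) :
    (fun n => v (aeval (seqShift K) (qIterate q P N) h n)) =O[atTop]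
      fun n => (r / max 1 (v q) ^ N) ^ n := by
  rcases le_total (v q) 1 with h1 | h1
  · simpa [max_eq_left h1] using growth_aeval_seqShift hh _
  rw [max_eq_right h1]
  induction N with
  | zero => simpa [qIterate] using hh
  | succ N ih =>
    rw [pow_succ, ← div_div]
    refine growth_of_seqScale hq ?_
    rw [seqScale_qIterate hq hrec hb]
    exact growth_aeval_seqShift ih _

/-- A nonarchimedean `v` is at most `1` on `P(σ) x` if it is on the coefficients of `P` and on the
terms of `x`. -/
theorem le_one_aeval_seqShift (hv : ∀ x y, v (x + y) ≤ max (v x) (v y)) {x : ℕ → K}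
    (hx : ∀ n, v (x n) ≤ 1) {P : K[X]} (hP : ∀ n, v (P.coeff n) ≤ 1) (n : ℕ) :
    v (aeval (seqShift K) P x n) ≤ 1 := by
  rw [aeval_eq_sum_range, LinearMap.sum_apply, Finset.sum_apply]
  refine Finset.sum_induction _ (fun y => v y ≤ 1) (fun a b ha hb => (hv a b).trans (max_le ha hb))
    (by simp) fun k _ => ?_
  rw [LinearMap.smul_apply, Pi.smul_apply, seqShift_pow_apply, smul_eq_mul, map_mul]
  exact mul_le_one₀ (hP k) (v.nonneg _) (hx _)

end Growth

/-! ### The product formula and eventual vanishing -/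

section ProductFormula

open NumberField

variable {K : Type*} [Field K] [NumberField K]

/-- The product formula turned into a vanishing criterion: if the local growth rates of a sequence
have product less than `1`, and its terms are integral outside a finite set of places, then it is
eventually zero. -/
theorem eventually_eq_zero_of_growth (x : ℕ → K) (r : InfinitePlace K → ℝ) (ρ : FinitePlace K → ℝ)
    (S : Finset (FinitePlace K)) (hr0 : ∀ w, 0 ≤ r w) (hρ0 : ∀ w, 0 ≤ ρ w)
    (hr : ∀ w, (fun n => w (x n)) =O[atTop] fun n => r w ^ n)
    (hρ : ∀ w ∈ S, (fun n => w (x n)) =O[atTop] fun n => ρ w ^ n)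
    (hS : ∀ w ∉ S, ∀ n, w (x n) ≤ 1)
    (hprod : (∏ w, r w ^ w.mult) * ∏ w ∈ S, ρ w < 1) :
    ∀ᶠ n in atTop, x n = 0 := by
  classical
  have h1 : (fun n => (∏ w : InfinitePlace K, w (x n) ^ w.mult) * ∏ w ∈ S, w (x n)) =O[atTop]
      fun n => ((∏ w, r w ^ w.mult) * ∏ w ∈ S, ρ w) ^ n := by
    refine ((IsBigO.finsetProd fun w _ => (hr w).pow w.mult).mul (IsBigO.finsetProd hρ)).congr_right
      fun n => ?_
    simp only [mul_pow, ← pow_mul, mul_comm n, ← Finset.prod_pow]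
  have hnn : 0 ≤ (∏ w, r w ^ w.mult) * ∏ w ∈ S, ρ w :=
    mul_nonneg (Finset.prod_nonneg fun w _ => pow_nonneg (hr0 w) _)
      (Finset.prod_nonneg fun w _ => hρ0 w)
  have h2 := h1.trans_tendsto (tendsto_pow_atTop_nhds_zero_of_lt_one hnn hprod)
  filter_upwards [h2.eventually (gt_mem_nhds zero_lt_one)] with n hn
  by_contra hx
  refine absurd (prod_abs_eq_one hx) (ne_of_lt (lt_of_le_of_lt ?_ hn))
  refine mul_le_mul_of_nonneg_left ?_ (Finset.prod_nonneg fun w _ => by positivity)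
  have hfin := FinitePlace.hasFiniteMulSupport hx
  rw [finprod_eq_prod_of_mulSupport_subset (s := S ∪ hfin.toFinset) _ (fun w hw => by
      rw [Finset.coe_union, hfin.coe_toFinset]; exact Or.inr hw),
    ← Finset.prod_sdiff Finset.subset_union_left]
  refine mul_le_of_le_one_left (Finset.prod_nonneg fun w _ => apply_nonneg w _) ?_
  exact Finset.prod_le_one (fun w _ => apply_nonneg w _)
    fun w hw => hS w (Finset.mem_sdiff.mp hw).2 n

/-- A nonzero `q` whose archimedean absolute values are not `1` is large at some place. -/
theorem exists_place_one_lt {q : K} (hq0 : q ≠ 0) (hq : ∀ w : InfinitePlace K, w q ≠ 1) :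
    (∃ w : InfinitePlace K, 1 < w q) ∨ ∃ w : FinitePlace K, 1 < w q := by
  classical
  by_contra! h
  have h1 : ∏ w : InfinitePlace K, w q ^ w.mult < 1 := by
    obtain ⟨w₀⟩ : Nonempty (InfinitePlace K) := inferInstance
    have hlt : w₀ q ^ w₀.mult < 1 :=
      pow_lt_one₀ (apply_nonneg w₀ q) (lt_of_le_of_ne (h.1 w₀) (hq w₀)) w₀.mult_ne_zero
    rw [← Finset.mul_prod_erase _ _ (Finset.mem_univ w₀)]
    refine lt_of_le_of_lt (mul_le_of_le_one_right (by positivity) ?_) hlt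
    exact Finset.prod_le_one (fun w _ => by positivity)
      fun w _ => pow_le_one₀ (apply_nonneg w q) (h.1 w)
  have h2 : ∏ᶠ w : FinitePlace K, w q ≤ 1 := by
    rw [finprod_eq_prod _ (FinitePlace.hasFiniteMulSupport hq0)]
    exact Finset.prod_le_one (fun w _ => apply_nonneg w _) fun w _ => h.2 w
  have h3 := prod_abs_eq_one hq0
  have h4 : 0 ≤ ∏ w : InfinitePlace K, w q ^ w.mult := Finset.prod_nonneg fun w _ => by positivity
  nlinarith

theorem finite_one_lt_finitePlace (x : K) : {w : FinitePlace K | 1 < w x}.Finite := by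
  by_cases hx : x = 0
  · simp [hx, not_lt.mpr zero_le_one]
  · exact (FinitePlace.hasFiniteMulSupport hx).subset fun w hw => ne_of_gt hw

/-- Global form of the decay of `Q_N(σ) h`: for large `N` the product over all places of the growth
rates drops below `1`, so `Q_N(σ) h` is eventually zero. -/
theorem exists_qIterate_eventually_eq_zero {q : K} (hq0 : q ≠ 0)
    (hq : ∀ w : InfinitePlace K, w q ≠ 1) {P R : K[X]} {h b : ℕ → K}
    (hrec : q • seqScale q h = aeval (seqShift K) R h - b)
    (hb : aeval (seqShift K) P b = 0)
    (hinf : ∀ w : InfinitePlace K, ∃ r > (0 : ℝ), (fun n => w (h n)) =O[atTop] fun n => r ^ n)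
    (hfin : ∀ w : FinitePlace K, ∃ r > (0 : ℝ), (fun n => w (h n)) =O[atTop] fun n => r ^ n)
    (hint : {w : FinitePlace K | ¬ ∀ n, w (h n) ≤ 1}.Finite) :
    ∃ N, ∀ᶠ n in atTop, aeval (seqShift K) (qIterate q P N) h n = 0 := by
  classical
  choose r hr0 hr using hinf
  have hfin' : ∀ w : FinitePlace K, ∃ r > (0 : ℝ), ((fun n => w (h n)) =O[atTop] fun n => r ^ n) ∧
      ((∀ n, w (h n) ≤ 1) → r = 1) := fun w => by
    by_cases hw : ∀ n, w (h n) ≤ 1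
    · refine ⟨1, one_pos, IsBigO.of_bound 1 (Eventually.of_forall fun n => ?_), fun _ => rfl⟩
      simpa [abs_of_nonneg (apply_nonneg w (h n))] using hw n
    · obtain ⟨r, h0, h1⟩ := hfin w
      exact ⟨r, h0, h1, fun h => absurd h hw⟩
  choose ρ hρ0 hρ hρ1 using hfin'
  -- outside `S₀` the rate is `1` and nothing is gained, so the bounds below do not depend on `N`
  let S₀ : Finset (FinitePlace K) := (finite_one_lt_finitePlace q).toFinset ∪ hint.toFinset
  have hS₀ : ∀ w ∉ S₀, w q ≤ 1 ∧ ∀ n, w (h n) ≤ 1 := fun w hw => by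
    simpa [S₀] using hw
  let H : ℝ := (∏ w : InfinitePlace K, (max 1 (w q)) ^ w.mult) * ∏ w ∈ S₀, max 1 (w q)
  let T : ℝ := (∏ w : InfinitePlace K, r w ^ w.mult) * ∏ w ∈ S₀, ρ w
  have hH : 1 < H := by
    have a1 : ∀ w : InfinitePlace K, 1 ≤ max 1 (w q) ^ w.mult :=
      fun w => one_le_pow₀ (le_max_left _ _)
    have a2 : ∀ w : FinitePlace K, 1 ≤ max 1 (w q) := fun w => le_max_left _ _
    have b1 : 1 ≤ ∏ w : InfinitePlace K, (max 1 (w q)) ^ w.mult := by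
      simpa using Finset.prod_le_prod (s := Finset.univ) (fun _ _ => zero_le_one) fun w _ => a1 w
    have b2 : 1 ≤ ∏ w ∈ S₀, max 1 (w q) := by
      simpa using Finset.prod_le_prod (s := S₀) (fun _ _ => zero_le_one) fun w _ => a2 w
    rcases exists_place_one_lt hq0 hq with ⟨w, hw⟩ | ⟨w, hw⟩
    · refine one_lt_mul_of_lt_of_le ?_ b2
      have := Finset.prod_lt_prod (s := Finset.univ) (fun _ _ => zero_lt_one) (fun w _ => a1 w)
        ⟨w, Finset.mem_univ w, one_lt_pow₀ (lt_max_of_lt_right hw) w.mult_ne_zero⟩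
      simpa using this
    · refine one_lt_mul_of_le_of_lt b1 ?_
      have := Finset.prod_lt_prod (s := S₀) (fun _ _ => zero_lt_one) (fun w _ => a2 w)
        ⟨w, by simp [S₀, hw], lt_max_of_lt_right hw⟩
      simpa using this
  obtain ⟨N, hN⟩ := pow_unbounded_of_one_lt T hH
  refine ⟨N, ?_⟩
  have hcoeff : {w : FinitePlace K | ¬ ∀ n, w ((qIterate q P N).coeff n) ≤ 1}.Finite := by
    refine (Set.Finite.biUnion (qIterate q P N).support.finite_toSet
      fun n _ => finite_one_lt_finitePlace ((qIterate q P N).coeff n)).subset fun w hw => ?_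
    simp only [Set.mem_ofPred_eq, not_forall, not_le] at hw
    obtain ⟨n, hn⟩ := hw
    refine Set.mem_biUnion (x := n) ?_ hn
    simp only [SetLike.mem_coe, mem_support_iff]
    rintro h0
    rw [h0, map_zero] at hn
    linarith
  let S := S₀ ∪ hcoeff.toFinset
  have hmax : ∀ x : ℝ, 0 < max 1 x := fun x => lt_max_of_lt_left one_pos
  refine eventually_eq_zero_of_growth _ (fun w => r w / max 1 (w q) ^ N)
    (fun w => ρ w / max 1 (w q) ^ N) S
    (fun w => (div_pos (hr0 w) (pow_pos (hmax _) N)).le)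
    (fun w => (div_pos (hρ0 w) (pow_pos (hmax _) N)).le)
    (fun w => growth_qIterate (v := w.1) hq0 hrec hb (hr w) N)
    (fun w _ => growth_qIterate (v := w.1) hq0 hrec hb (hρ w) N) (fun w hw => ?_) ?_
  · rw [Finset.notMem_union] at hw
    exact le_one_aeval_seqShift (v := w.1) w.add_le (hS₀ w hw.1).2
      (not_not.mp fun hc => hw.2 (hcoeff.mem_toFinset.mpr hc))
  · have e : ∏ w ∈ S, ρ w / max 1 (w q) ^ N = ∏ w ∈ S₀, ρ w / max 1 (w q) ^ N := by
      refine (Finset.prod_subset Finset.subset_union_left fun w _ hw => ?_).symm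
      rw [hρ1 w (hS₀ w hw).2, max_eq_left (hS₀ w hw).1, one_pow, div_one]
    have e2 : (∏ w : InfinitePlace K, (r w / max 1 (w q) ^ N) ^ w.mult) *
        ∏ w ∈ S₀, ρ w / max 1 (w q) ^ N = T / H ^ N := by
      simp only [T, H, div_pow, Finset.prod_div_distrib, mul_pow, ← pow_mul,
        mul_comm N, ← Finset.prod_pow]
      rw [div_mul_div_comm]
    rw [e, e2, div_lt_one (by positivity)]
    exact hN

end ProductFormula

/-! ### The quotient `F(z) / (z - ξ)` -/

section Remainder

variable {K : Type*} [Field K]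

/-- The coefficients `a_n = n_q! f_n` of `F(z) = ∑ f_n z ^ n = β₀ + ∑ β_i E_q(α_i z)`. -/
def qCoeff {m : ℕ} (α : Fin m → K) (β₀ : K) (β : Fin m → K) (n : ℕ) : K :=
  (if n = 0 then β₀ else 0) + ∑ i, β i * α i ^ n

/-- The sequence `h_n = n_q! g_n`, where `F(z) / (z - ξ) = ∑ g_n z ^ n` as formal power series and
`F(z) = ∑ (a_n / n_q!) z ^ n`. -/
noncomputable def qQuotient (q ξ : K) (a : ℕ → K) (n : ℕ) : K :=
  -(qFact q n / ξ ^ (n + 1)) * ∑ k ∈ Finset.range (n + 1), a k * ξ ^ k / qFact q k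

theorem qFact_succ (q : K) (n : ℕ) : qFact q (n + 1) = qFact q n * qInt q (n + 1) := by
  rw [qFact, Finset.prod_Icc_succ_top (by omega), ← qFact]

@[simp] theorem qFact_zero (q : K) : qFact q 0 = 1 := by simp [qFact]

theorem qInt_ne_zero {q : K} (hq : ∀ n : ℕ, q ^ (n + 1) ≠ 1) (n : ℕ) : qInt q (n + 1) ≠ 0 :=
  div_ne_zero (sub_ne_zero.mpr (hq n).symm)
    (sub_ne_zero.mpr fun h => hq 0 (by simp [← h]))

theorem qFact_ne_zero {q : K} (hq : ∀ n : ℕ, q ^ (n + 1) ≠ 1) (n : ℕ) : qFact q n ≠ 0 := by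
  induction n with
  | zero => simp
  | succ n ih => rw [qFact_succ]; exact mul_ne_zero ih (qInt_ne_zero hq n)

theorem qQuotient_zero {q ξ : K} (hξ : ξ ≠ 0) (a : ℕ → K) : ξ * qQuotient q ξ a 0 = -a 0 := by
  simp [qQuotient]
  field_simp

theorem qQuotient_succ {q ξ : K} (hq : ∀ n : ℕ, q ^ (n + 1) ≠ 1) (hξ : ξ ≠ 0) (a : ℕ → K) (n : ℕ) :
    ξ * qQuotient q ξ a (n + 1) = qInt q (n + 1) * qQuotient q ξ a n - a (n + 1) := by
  have h1 := qFact_ne_zero hq n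
  have h2 := qInt_ne_zero hq n
  rw [qQuotient, Finset.sum_range_succ _ (n + 1), qQuotient, qFact_succ]
  field_simp
  ring

/-- The `q`-difference equation of `∑ h_n z ^ n`. -/
theorem seqScale_qQuotient {q ξ : K} (hq : ∀ n : ℕ, q ^ (n + 1) ≠ 1) (hξ : ξ ≠ 0) (a : ℕ → K) :
    q • seqScale q (qQuotient q ξ a) =
      aeval (seqShift K) (1 - C ((1 - q) * ξ) * X) (qQuotient q ξ a) -
        fun n => (1 - q) * a (n + 1) := by
  have h1 : 1 - q ≠ 0 := sub_ne_zero.mpr fun h => hq 0 (by simp [← h])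
  ext n
  have h2 := qQuotient_succ hq hξ a n
  have h3 : (1 - q) * qInt q (n + 1) = 1 - q ^ (n + 1) := mul_div_cancel₀ _ h1
  simp [Module.algebraMap_end_apply]
  linear_combination (1 - q) * h2 + qQuotient q ξ a n * h3

variable (v : AbsoluteValue K ℝ)

theorem exists_bound_qCoeff {m : ℕ} (α : Fin m → K) (β₀ : K) (β : Fin m → K) :
    ∃ A M : ℝ, 0 ≤ A ∧ 1 ≤ M ∧ ∀ n, v (qCoeff α β₀ β n) ≤ A * M ^ n := by
  have hs : 0 ≤ ∑ i, v (α i) := Finset.sum_nonneg fun i _ => v.nonneg _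
  refine ⟨v β₀ + ∑ i, v (β i), 1 + ∑ i, v (α i),
    add_nonneg (v.nonneg _) (Finset.sum_nonneg fun i _ => v.nonneg _), by linarith, fun n => ?_⟩
  have hM : 1 ≤ (1 + ∑ i, v (α i)) ^ n := one_le_pow₀ (by linarith)
  refine (v.add_le _ _).trans ?_
  rw [add_mul, Finset.sum_mul]
  refine add_le_add ?_ ((v.sum_le _ _).trans (Finset.sum_le_sum fun i _ => ?_))
  · have : v (if n = 0 then β₀ else 0) ≤ v β₀ := by split_ifs <;> simp
    exact this.trans (le_mul_of_one_le_right (v.nonneg _) hM)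
  · rw [map_mul, map_pow]
    refine mul_le_mul_of_nonneg_left (pow_le_pow_left₀ (v.nonneg _) ?_ n) (v.nonneg _)
    have := Finset.single_le_sum (f := fun i => v (α i)) (fun i _ => v.nonneg _) (Finset.mem_univ i)
    linarith

variable {v}

/-- Where the `q`-integers are bounded, the recurrence alone gives geometric growth. -/
theorem growth_qQuotient_of_bounded {q ξ : K} (hq : ∀ n : ℕ, q ^ (n + 1) ≠ 1) (hξ : ξ ≠ 0)
    {a : ℕ → K} {A M B : ℝ} (hA : 0 ≤ A) (hM : 1 ≤ M) (ha : ∀ n, v (a n) ≤ A * M ^ n)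
    (hB : ∀ n, v (qInt q n) ≤ B) :
    ∃ r > (0 : ℝ), (fun n => v (qQuotient q ξ a n)) =O[atTop] fun n => r ^ n := by
  have hvξ : 0 < v ξ := v.pos hξ
  -- the recurrence needs `B r ^ n + M r ^ n ≤ |ξ|_v r ^ (n + 1)`
  set r := max M ((B + M) / v ξ)
  have hMr : M ≤ r := le_max_left _ _
  have hr0 : 0 < r := by linarith
  have hB0 : 0 ≤ B := (v.nonneg _).trans (hB 0)
  have hr : B + M ≤ r * v ξ := (div_le_iff₀ hvξ).mp (le_max_right _ _)
  set c := A + v (qQuotient q ξ a 0)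
  have hAc : A ≤ c := by simp [c]
  have key : ∀ n, v (qQuotient q ξ a n) ≤ c * r ^ n := by
    intro n
    induction n with
    | zero => simp [c, hA]
    | succ n ih =>
      refine le_of_mul_le_mul_left ?_ hvξ
      have hrn : 0 < r ^ n := by positivity
      have e1 : v (qInt q (n + 1) * qQuotient q ξ a n) ≤ B * (c * r ^ n) := by
        rw [map_mul]; exact mul_le_mul (hB _) ih (v.nonneg _) hB0
      have e2 : v (a (n + 1)) ≤ c * (M * r ^ n) := by
        refine (ha _).trans ?_
        rw [pow_succ']
        gcongr
      rw [← map_mul, qQuotient_succ hq hξ]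
      calc v (qInt q (n + 1) * qQuotient q ξ a n - a (n + 1))
          ≤ v (qInt q (n + 1) * qQuotient q ξ a n) + v (a (n + 1)) := v.sub_le_add _ _
        _ ≤ B * (c * r ^ n) + c * (M * r ^ n) := add_le_add e1 e2
        _ = (B + M) * (c * r ^ n) := by ring
        _ ≤ (r * v ξ) * (c * r ^ n) :=
          mul_le_mul_of_nonneg_right hr (mul_nonneg (hA.trans hAc) hrn.le)
        _ = v ξ * (c * r ^ (n + 1)) := by ring
  refine ⟨r, hr0, IsBigO.of_bound c (Eventually.of_forall fun n => ?_)⟩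
  simpa [abs_of_nonneg (v.nonneg _), abs_of_pos hr0] using key n

/-- If a convergent series with sum `0` is majorized by a sequence which eventually halves at each
step, then its partial sums are bounded by twice the first omitted majorant. -/
theorem norm_sum_range_le_of_halving {L : Type*} [NormedField L] {f : ℕ → L} {μ : ℕ → ℝ}
    (hf : ∀ n, ‖f n‖ ≤ μ n) {k₀ : ℕ} (hμ : ∀ k ≥ k₀, μ (k + 1) ≤ μ k * (1 / 2)) (h0 : HasSum f 0)
    {n : ℕ} (hn : k₀ ≤ n) : ‖∑ k ∈ Finset.range n, f k‖ ≤ 2 * μ n := by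
  have hgeom : ∀ j, μ (n + j) ≤ μ n * (1 / 2) ^ j := by
    intro j
    induction j with
    | zero => simp
    | succ j ih =>
      rw [pow_succ, ← mul_assoc, ← add_assoc]
      exact (hμ _ (by omega)).trans (by gcongr)
  have ht : Tendsto (fun j => ∑ k ∈ Finset.range (n + j), f k) atTop (𝓝 0) :=
    h0.tendsto_sum_nat.comp (tendsto_atTop_mono (fun j => Nat.le_add_left j n) tendsto_id)
  have := dist_le_of_le_geometric_of_tendsto₀ (1 / 2) (μ n) (by norm_num) (fun j => ?_) ht
  · rw [dist_zero_right, add_zero] at this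
    exact this.trans_eq (by ring)
  · rw [← add_assoc, Finset.sum_range_succ, dist_self_add_right]
    exact (hf _).trans (hgeom j)

theorem toCompletion_qFact (v : AbsoluteValue K ℝ) (q : K) (n : ℕ) :
    toCompletion v (qFact q n) = qFact (toCompletion v q) n := by
  simp [qFact, qInt, map_prod, map_div₀]

theorem hasSum_qExpSum {q : K} (hq : 1 < v q) {m : ℕ} (α : Fin m → K) (β₀ : K) (β : Fin m → K)
    (ξ : K) :
    HasSum (fun n => toCompletion v (qCoeff α β₀ β n * ξ ^ n / qFact q n))
      (qExpSum v q α β₀ β (toCompletion v ξ)) := by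
  have hq' : 1 < ‖toCompletion v q‖ := by rwa [norm_toCompletion]
  have h0 : HasSum (fun n : ℕ => if n = 0 then toCompletion v β₀ else 0) (toCompletion v β₀) :=
    hasSum_ite_eq 0 _
  have h1 := hasSum_sum (s := Finset.univ) fun i _ =>
    ((summable_qExp hq' (toCompletion v (α i) * toCompletion v ξ)).hasSum.mul_left
      (toCompletion v (β i)))
  refine (h0.add h1).congr_fun fun n => ?_
  rw [qCoeff, map_div₀, toCompletion_qFact, map_mul, map_add, add_mul, add_div, map_sum,
    Finset.sum_mul, Finset.sum_div]
  congr 1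
  · rcases eq_or_ne n 0 with rfl | hn <;> simp [*]
  · refine Finset.sum_congr rfl fun i _ => ?_
    simp only [map_mul, map_pow, mul_pow]
    ring

/-- Where `|q|_v > 1`, the vanishing of `F` at `ξ` makes `h_n` a tail of the series `F(ξ)`, up to the
factor `n_q! ξ ^ (-n-1)`, whence geometric growth. -/
theorem growth_qQuotient_of_vanish {q ξ : K} (hq0 : ∀ n : ℕ, q ^ (n + 1) ≠ 1) (hξ : ξ ≠ 0)
    (hq : 1 < v q) {a : ℕ → K} {A M : ℝ} (hA : 0 ≤ A) (hM : 1 ≤ M)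
    (ha : ∀ n, v (a n) ≤ A * M ^ n)
    (hsum : HasSum (fun n => toCompletion v (a n * ξ ^ n / qFact q n)) 0) :
    ∃ r > (0 : ℝ), (fun n => v (qQuotient q ξ a n)) =O[atTop] fun n => r ^ n := by
  have hvξ : 0 < v ξ := v.pos hξ
  have hfac : ∀ n, 0 < v (qFact q n) := fun n => v.pos (qFact_ne_zero hq0 n)
  -- a majorant of the terms with computable ratios, which the terms themselves need not have
  let μ : ℕ → ℝ := fun n => A * (M * v ξ) ^ n / v (qFact q n)
  have hf : ∀ n, ‖toCompletion v (a n * ξ ^ n / qFact q n)‖ ≤ μ n := fun n => by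
    rw [norm_toCompletion, map_div₀, map_mul, map_pow]
    refine div_le_div_of_nonneg_right ?_ (hfac n).le
    rw [mul_pow, ← mul_assoc]
    exact mul_le_mul_of_nonneg_right (ha n) (by positivity)
  have hqint : Tendsto (fun n => v (qInt q n)) atTop atTop := by
    have : Tendsto (fun n => ‖qInt (toCompletion v q) n‖) atTop atTop :=
      tendsto_norm_qInt (by rwa [norm_toCompletion])
    refine this.congr fun n => ?_
    rw [← norm_toCompletion v (qInt q n)]
    simp [qInt, map_div₀]
  obtain ⟨k₀, hk₀⟩ := eventually_atTop.mp
    ((hqint.comp (tendsto_add_atTop_nat 1)).eventually_ge_atTop (max 1 (2 * (M * v ξ))))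
  simp only [Function.comp, max_le_iff] at hk₀
  have hμ0 : ∀ n, 0 ≤ μ n := fun n =>
    div_nonneg (mul_nonneg hA (pow_nonneg (by positivity) n)) (hfac n).le
  have hμs : ∀ n, μ (n + 1) = μ n * (M * v ξ / v (qInt q (n + 1))) := fun n => by
    simp only [μ, qFact_succ, map_mul, pow_succ]
    rw [div_mul_div_comm, mul_assoc]
  have hμ : ∀ k ≥ k₀, μ (k + 1) ≤ μ k * (1 / 2) := fun k hk => by
    rw [hμs]
    refine mul_le_mul_of_nonneg_left ?_ (hμ0 k)
    rw [div_le_iff₀ (by linarith [(hk₀ k hk).1])]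
    linarith [(hk₀ k hk).2]
  refine ⟨M, by linarith, IsBigO.of_bound (2 * A * M) ?_⟩
  filter_upwards [eventually_ge_atTop k₀] with n hn
  have h1 := norm_sum_range_le_of_halving hf hμ hsum (n := n + 1) (by omega)
  rw [← map_sum, norm_toCompletion] at h1
  have hint := (hk₀ n hn).1
  rw [Real.norm_of_nonneg (v.nonneg _), Real.norm_of_nonneg (by positivity), qQuotient, map_mul,
    map_neg_eq_map, map_div₀, map_pow]
  calc v (qFact q n) / v ξ ^ (n + 1) *
        v (∑ k ∈ Finset.range (n + 1), a k * ξ ^ k / qFact q k)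
      ≤ v (qFact q n) / v ξ ^ (n + 1) * (2 * μ (n + 1)) :=
        mul_le_mul_of_nonneg_left h1 (div_nonneg (hfac n).le (by positivity))
    _ = 2 * A * M * M ^ n / v (qInt q (n + 1)) := by
        have := hfac n
        simp only [μ, qFact_succ, map_mul]
        field_simp
        ring
    _ ≤ 2 * A * M * M ^ n := div_le_self (by positivity) hint

end Remainder

/-! ### Resonances of the `q`-difference equation -/

section Resonance

variable {K : Type*} [Field K]

/-- A solution `h` of the `q`-difference equation which is eventually a combination of the geometric
sequences `(q ^ (-k) α_i) ^ n` with `1 ≤ k ≤ N` forces the resonance `(1 - q) ξ α_i = q ^ k` for some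
`k ≥ 1` whenever `β_i ≠ 0`: the coefficients at `q ^ (-k) α_i` satisfy a first-order recurrence in
`k`, which starts with a nonzero value and has to reach `0`. -/
theorem exists_resonance {m : ℕ} {q ξ : K} {α β : Fin m → K} (hq0 : q ≠ 0)
    (hq : ∀ n : ℕ, q ^ (n + 1) ≠ 1) (hα : ∀ i, α i ≠ 0)
    (hinj : Function.Injective fun p : ℕ × Fin m => α p.2 / q ^ p.1) {h : ℕ → K} {N : ℕ}
    (hrec : q • seqScale q h = aeval (seqShift K) (1 - C ((1 - q) * ξ) * X) h -
      fun n => (1 - q) * ∑ i, β i * α i ^ (n + 1))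
    (hN : ∀ᶠ n in atTop, aeval (seqShift K) (qIterate q (∏ i, (X - C (α i))) N) h n = 0)
    (i : Fin m) (hβ : β i ≠ 0) : ∃ k : ℕ, (1 - q) * ξ * α i = q ^ (k + 1) := by
  obtain ⟨n₀, hn₀⟩ := eventually_atTop.mp hN
  have hpow : ∀ (x : ℕ → K) (n : ℕ), aeval (seqShift K) (X ^ n₀ : K[X]) x n = x (n₀ + n) :=
    fun x n => by rw [map_pow, aeval_X, seqShift_pow_apply, add_comm]
  obtain ⟨c₀, hc₀, hQ⟩ := qIterate_prod_X_sub_C hq0 α N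
  have hy : aeval (seqShift K) (∏ p ∈ Finset.range N ×ˢ Finset.univ,
      (X - C (α p.2 / q ^ (p.1 + 1)))) (aeval (seqShift K) (X ^ n₀ : K[X]) h) = 0 := by
    have h1 : aeval (seqShift K) (qIterate q (∏ i, (X - C (α i))) N)
        (aeval (seqShift K) (X ^ n₀ : K[X]) h) = 0 := by
      rw [← Module.End.mul_apply, ← map_mul, mul_comm, map_mul, Module.End.mul_apply]
      ext n
      rw [hpow]
      exact hn₀ _ (Nat.le_add_right _ _)
    rw [hQ, ← smul_eq_C_mul, map_smul, LinearMap.smul_apply] at h1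
    rw [Finset.prod_product]
    exact (smul_eq_zero.mp h1).resolve_left hc₀
  have hinj' : Function.Injective fun p : ℕ × Fin m => α p.2 / q ^ (p.1 + 1) := fun a b hab => by
    have := @hinj (a.1 + 1, a.2) (b.1 + 1, b.2) hab
    simp only [Prod.mk.injEq, add_left_inj] at this
    exact Prod.ext this.1 this.2
  obtain ⟨c, hc⟩ := exists_eq_sum_geom _ hinj' _ hy
  simp only [hpow, Finset.sum_product] at hc
  -- the coefficients at `q ^ (-k) α_j`, extended by zero outside `1 ≤ k ≤ N`
  let d : ℕ → Fin m → K := fun k j => if k = 0 ∨ N < k then 0 else c (k - 1, j)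
  have d0 : ∀ j, d 0 j = 0 := fun j => by simp [d]
  have dN : ∀ j, d (N + 1) j = 0 := fun j => by simp [d]
  have hd : ∀ n, h (n₀ + n) =
      ∑ k ∈ Finset.range N, ∑ j, d (k + 1) j * (α j / q ^ (k + 1)) ^ n := fun n => by
    rw [hc]
    refine Finset.sum_congr rfl fun k hk => Finset.sum_congr rfl fun j _ => ?_
    have : ¬ (k + 1 = 0 ∨ N < k + 1) := by have := Finset.mem_range.mp hk; omega
    simp only [d, if_neg this, Nat.add_sub_cancel]
  have hd1 : ∀ n, h (n₀ + n) =
      ∑ k ∈ Finset.range (N + 1), ∑ j, d k j * (α j / q ^ k) ^ n := fun n => by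
    rw [Finset.sum_range_succ', hd]
    simp [d0]
  have hd2 : ∀ n, h (n₀ + n) =
      ∑ k ∈ Finset.range (N + 1), ∑ j, d (k + 1) j * (α j / q ^ (k + 1)) ^ n := fun n => by
    rw [Finset.sum_range_succ, hd]
    simp [dN]
  -- the coefficient of `(q ^ (-k) α_j) ^ n` after substitution into the recurrence
  let e : ℕ × Fin m → K := fun p => q ^ (n₀ + 1) * d (p.1 + 1) p.2 -
    (1 - (1 - q) * ξ * (α p.2 / q ^ p.1)) * d p.1 p.2 +
      if p.1 = 0 then (1 - q) * (β p.2 * α p.2 ^ (n₀ + 1)) else 0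
  have he : ∀ n : ℕ, ∑ p ∈ Finset.range (N + 1) ×ˢ Finset.univ,
      e p * (α p.2 / q ^ p.1) ^ n = 0 := by
    intro n
    have h1 := congr_fun hrec (n₀ + n)
    simp only [Pi.smul_apply, smul_eq_mul, seqScale_apply, map_sub, map_one, map_mul, aeval_C,
      aeval_X, LinearMap.sub_apply, Module.End.one_apply, Module.End.mul_apply, Pi.sub_apply,
      Module.algebraMap_end_apply, seqShift_apply] at h1
    have h2 : q ^ n * h (n₀ + n) =
        ∑ k ∈ Finset.range (N + 1), ∑ j, d (k + 1) j * (α j / q ^ k) ^ n := by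
      rw [hd2, Finset.mul_sum]
      refine Finset.sum_congr rfl fun k _ => ?_
      rw [Finset.mul_sum]
      refine Finset.sum_congr rfl fun j _ => ?_
      rw [mul_left_comm, ← mul_pow]
      congr 2
      field_simp
      ring
    have h3 : ∑ k ∈ Finset.range (N + 1), ∑ j : Fin m,
        (if k = 0 then (1 - q) * (β j * α j ^ (n₀ + 1)) else 0) * (α j / q ^ k) ^ n =
        (1 - q) * ∑ j, β j * α j ^ (n₀ + n + 1) := by
      rw [Finset.sum_range_succ', Finset.mul_sum]
      simp only [Nat.succ_ne_zero, if_false, zero_mul, Finset.sum_const_zero, zero_add, if_true,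
        pow_zero, div_one]
      refine Finset.sum_congr rfl fun j _ => ?_
      ring
    have h4 := hd1 n
    have h5 := hd1 (n + 1)
    rw [← add_assoc] at h5
    have h6 : q ^ (n₀ + 1) * (q ^ n * h (n₀ + n)) - h (n₀ + n) + (1 - q) * ξ * h (n₀ + n + 1) +
        (1 - q) * ∑ j, β j * α j ^ (n₀ + n + 1) = 0 := by
      linear_combination h1
    rw [h2, h4, h5, ← h3] at h6
    rw [Finset.sum_product, ← h6]
    simp only [Finset.mul_sum, ← Finset.sum_add_distrib, ← Finset.sum_sub_distrib]
    refine Finset.sum_congr rfl fun k _ => Finset.sum_congr rfl fun j _ => ?_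
    simp only [e]
    ring
  have he0 : ∀ k ≤ N, e (k, i) = 0 := fun k hk =>
    geom_linearIndependent _ hinj he (k, i) (by simpa [Nat.lt_succ_iff] using hk)
  by_contra! hne
  have hq1 : 1 - q ≠ 0 := sub_ne_zero.mpr fun h => hq 0 (by simp [← h])
  have hd_ne : ∀ k ≤ N, d (k + 1) i ≠ 0 := by
    intro k
    induction k with
    | zero =>
      intro hk h0
      have := he0 0 hk
      simp only [e, zero_add, h0, d0, mul_zero, sub_zero, if_true] at this
      exact mul_ne_zero hq1 (mul_ne_zero hβ (pow_ne_zero _ (hα i))) this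
    | succ k ih =>
      intro hk h0
      have := he0 (k + 1) hk
      simp only [e, h0, mul_zero, zero_sub, Nat.succ_ne_zero, if_false, add_zero,
        neg_eq_zero] at this
      have h1 := (mul_eq_zero.mp this).resolve_right (ih (by omega))
      refine hne k ?_
      have hqk : q ^ (k + 1) ≠ 0 := pow_ne_zero _ hq0
      rw [sub_eq_zero, ← mul_div_assoc, eq_div_iff hqk, one_mul] at h1
      exact h1.symm
  exact hd_ne N le_rfl (dN i)

end Resonance

/-! ### Zeros of the `q`-exponential -/

section Zeros

theorem pow_succ_ne_one_of_one_lt_norm {L : Type*} [NormedField L] {q : L} (hq : 1 < ‖q‖) (n : ℕ) :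
    q ^ (n + 1) ≠ 1 := fun h =>
  (one_lt_pow₀ hq n.succ_ne_zero).ne' (by rw [← norm_pow, h, norm_one])

variable {L : Type*} [NormedField L] [CompleteSpace L]

/-- The functional equation `E_q(q z) = (1 + (q - 1) z) E_q(z)`. -/
theorem qExp_mul_left {q : L} (hq : 1 < ‖q‖) (z : L) :
    qExp q (q * z) = (1 + (q - 1) * z) * qExp q z := by
  have hq' := pow_succ_ne_one_of_one_lt_norm hq
  have h1 : 1 - q ≠ 0 := sub_ne_zero.mpr fun h => hq' 0 (by simp [← h])
  have s1 := (summable_qExp hq (q * z)).hasSum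
  have s2 := (summable_qExp hq z).hasSum
  have s3 := (hasSum_nat_add_iff' 1).mpr (s1.sub s2)
  simp only [Finset.range_one, Finset.sum_singleton, pow_zero, sub_self, sub_zero] at s3
  have s4 := s2.mul_left ((q - 1) * z)
  have e := (s3.congr_fun fun n => ?_).unique s4
  · change qExp q (q * z) - qExp q z = (q - 1) * z * qExp q z at e
    linear_combination e
  · have h2 := qFact_ne_zero hq' n
    have h3 := sub_ne_zero.mpr (hq' n).symm
    rw [qFact_succ, qInt]
    field_simp
    ring

/-- The points `q ^ k / (1 - q)` with `k ≥ 1` are zeros of `E_q`. -/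
theorem qExp_eq_zero {q : L} (hq : 1 < ‖q‖) (k : ℕ) {z : L} (hz : (1 - q) * z = q ^ (k + 1)) :
    qExp q z = 0 := by
  have hq0 : q ≠ 0 := by rintro rfl; simp [not_lt.mpr zero_le_one] at hq
  have e : q * (z / q) = z := mul_div_cancel₀ _ hq0
  have h1 : (1 - q) * (z / q) = q ^ k := by
    rw [← mul_div_assoc, hz, pow_succ, mul_div_cancel_right₀ _ hq0]
  rw [← e, qExp_mul_left hq]
  induction k generalizing z with
  | zero =>
    rw [pow_zero] at h1
    have : 1 + (q - 1) * (z / q) = 0 := by linear_combination -h1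
    rw [this, zero_mul]
  | succ k ih =>
    have e' : q * (z / q / q) = z / q := mul_div_cancel₀ _ hq0
    have h2 : (1 - q) * (z / q / q) = q ^ k := by
      rw [← mul_div_assoc, h1, pow_succ, mul_div_cancel_right₀ _ hq0]
    have := ih h1 e' h2
    rw [← qExp_mul_left hq, e'] at this
    rw [this, mul_zero]

end Zeros

/-! ### Integrality at almost all places -/

section Integrality

open NumberField

variable {K : Type*} [Field K] [NumberField K]

theorem qQuotient_le_one {v : FinitePlace K} {q ξ : K} (hq0 : ∀ n : ℕ, q ^ (n + 1) ≠ 1)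
    (hξ0 : ξ ≠ 0) {a : ℕ → K} (hq : v q ≤ 1) (hξ : v ξ⁻¹ ≤ 1) (ha : ∀ n, v (a n) ≤ 1) (n : ℕ) :
    v (qQuotient q ξ a n) ≤ 1 := by
  have hint : ∀ n, v (qInt q n) ≤ 1 := fun n => by
    have h1 : q ≠ 1 := fun h => hq0 0 (by simp [h])
    have e : qInt q n = ∑ i ∈ Finset.range n, q ^ i := by
      rw [geom_sum_eq h1, qInt, ← neg_sub, ← neg_sub q, neg_div_neg_eq]
    rw [e]
    refine Finset.sum_induction _ (fun y => v y ≤ 1)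
      (fun a b ha hb => (v.add_le a b).trans (max_le ha hb)) (by simp) fun i _ => ?_
    rw [map_pow]
    exact pow_le_one₀ (apply_nonneg _ _) hq
  induction n with
  | zero =>
    have e : qQuotient q ξ a 0 = ξ⁻¹ * -a 0 := by
      rw [← qQuotient_zero hξ0, inv_mul_cancel_left₀ hξ0]
    rw [e, map_mul, map_neg_eq_map]
    exact mul_le_one₀ hξ (apply_nonneg _ _) (ha 0)
  | succ n ih =>
    have e : qQuotient q ξ a (n + 1) = ξ⁻¹ * (qInt q (n + 1) * qQuotient q ξ a n + -a (n + 1)) := by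
      rw [← sub_eq_add_neg, ← qQuotient_succ hq0 hξ0, inv_mul_cancel_left₀ hξ0]
    rw [e, map_mul]
    refine mul_le_one₀ hξ (apply_nonneg _ _) ((v.add_le _ _).trans (max_le ?_ ?_))
    · rw [map_mul]
      exact mul_le_one₀ (hint _) (apply_nonneg _ _) ih
    · rw [map_neg_eq_map]
      exact ha _

theorem finite_not_forall_qQuotient_le_one {q ξ : K} (hq : ∀ n : ℕ, q ^ (n + 1) ≠ 1) (hξ : ξ ≠ 0)
    {m : ℕ} (α : Fin m → K) (β₀ : K) (β : Fin m → K) :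
    {w : FinitePlace K | ¬ ∀ n, w (qQuotient q ξ (qCoeff α β₀ β) n) ≤ 1}.Finite := by
  refine ((finite_one_lt_finitePlace q).union ((finite_one_lt_finitePlace ξ⁻¹).union
    ((finite_one_lt_finitePlace β₀).union ((Set.finite_iUnion fun i =>
      finite_one_lt_finitePlace (β i)).union (Set.finite_iUnion fun i =>
        finite_one_lt_finitePlace (α i)))))).subset fun w hw => ?_
  contrapose hw
  simp only [Set.mem_union, Set.mem_iUnion, Set.mem_ofPred_eq, not_or, not_exists, not_lt] at hw
  obtain ⟨h1, h2, h3, h4, h5⟩ := hw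
  refine fun hbad => hbad fun n => qQuotient_le_one hq hξ h1 h2 (fun n => ?_) n
  refine (w.add_le _ _).trans (max_le ?_ ?_)
  · split_ifs
    · exact h3
    · simp
  · refine Finset.sum_induction _ (fun y => w y ≤ 1)
      (fun a b ha hb => (w.add_le a b).trans (max_le ha hb)) (by simp) fun i _ => ?_
    rw [map_mul, map_pow]
    exact mul_le_one₀ (h4 i) (by positivity) (pow_le_one₀ (apply_nonneg _ _) (h5 i))

end Integrality

/-! ### Classes modulo powers of `q` -/

section QuotientGroup

theorem injective_div_pow_of_injective_mk {K : Type*} [Field K] {m : ℕ} {q : Kˣ} {α : Fin m → Kˣ}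
    (hq : ∀ n : ℕ, (q : K) ^ (n + 1) ≠ 1)
    (hα : Function.Injective fun i => (QuotientGroup.mk (α i) : Kˣ ⧸ Subgroup.zpowers q)) :
    Function.Injective fun p : ℕ × Fin m => (α p.2 : K) / (q : K) ^ p.1 := by
  have hpow : Function.Injective fun k : ℕ => q ^ k := by
    refine injective_pow_iff_not_isOfFinOrder.mpr fun h => ?_
    obtain ⟨n, hn, h1⟩ := isOfFinOrder_iff_pow_eq_one.mp h
    obtain ⟨k, rfl⟩ := Nat.exists_eq_add_of_lt hn
    exact hq k (by simpa [Units.ext_iff] using h1)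
  rintro ⟨k, i⟩ ⟨l, j⟩ h
  have h' : α i / q ^ k = α j / q ^ l := Units.ext (by simpa using h)
  have hij : i = j := by
    refine hα (QuotientGroup.eq.mpr ?_)
    have e : (α i)⁻¹ * α j = q ^ l / q ^ k := by
      rw [div_eq_div_iff_mul_eq_mul] at h'
      rw [inv_mul_eq_iff_eq_mul, ← mul_div_assoc, h', mul_div_cancel_right]
    rw [e]
    exact div_mem (Subgroup.npow_mem_zpowers q l) (Subgroup.npow_mem_zpowers q k)
  subst hij
  rw [div_right_inj] at h'
  rw [hpow h']

end QuotientGroup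

/-! ### Vanishing of the linear combination -/

theorem mainTheorem7 {K : Type*} [Field K] [NumberField K] (m : ℕ) (q ξ : Kˣ) (α : Fin m → Kˣ)
    (β₀ : K) (β : Fin m → K)
    (hq : ∀ v : NumberField.InfinitePlace K, v (q : K) ≠ 1)
    (hα : Function.Injective fun i => (QuotientGroup.mk (α i) : Kˣ ⧸ Subgroup.zpowers q))
    (hvanish : ∀ v : AbsoluteValue K ℝ, IsPlace v → 1 < v (q : K) →
      qExpSum v (q : K) (fun i => (α i : K)) β₀ β (toCompletion v (ξ : K)) = 0) :
    β₀ = 0 ∧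
      ∀ v : AbsoluteValue K ℝ, IsPlace v → 1 < v (q : K) → ∀ i,
        toCompletion v (β i) *
          qExp (toCompletion v (q : K)) (toCompletion v (α i : K) * toCompletion v (ξ : K)) = 0 := by
  have hq1 : ∀ n : ℕ, (q : K) ^ (n + 1) ≠ 1 := fun n h => by
    obtain ⟨w⟩ : Nonempty (NumberField.InfinitePlace K) := inferInstance
    refine hq w ((pow_eq_one_iff_of_nonneg (apply_nonneg w _) n.succ_ne_zero).mp ?_)
    rw [← map_pow, h, map_one]
  set a : ℕ → K := qCoeff (fun i => (α i : K)) β₀ β with ha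
  set h := qQuotient (q : K) (ξ : K) a
  have hgrowth : ∀ v : AbsoluteValue K ℝ, IsPlace v →
      ∃ r > (0 : ℝ), (fun n => v (h n)) =O[atTop] fun n => r ^ n := by
    intro v hv
    obtain ⟨A, M, hA, hM, hb⟩ := exists_bound_qCoeff v (fun i => (α i : K)) β₀ β
    rcases le_or_gt (v (q : K)) 1 with h1 | h1
    · refine growth_qQuotient_of_bounded hq1 ξ.ne_zero hA hM hb (B := 2 / v (1 - q)) fun n => ?_
      rw [qInt, map_div₀]
      refine div_le_div_of_nonneg_right ((v.sub_le_add _ _).trans ?_) (v.nonneg _)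
      have := pow_le_one₀ (n := n) (v.nonneg _) h1
      rw [map_one, map_pow]
      linarith
    · refine growth_qQuotient_of_vanish hq1 ξ.ne_zero h1 hA hM hb ?_
      rw [← hvanish v hv h1]
      exact hasSum_qExpSum h1 _ _ _ _
  have hrec : (q : K) • seqScale (q : K) h =
      aeval (seqShift K) (1 - C ((1 - (q : K)) * ξ) * X) h -
        fun n => (1 - (q : K)) * ∑ i, β i * (α i : K) ^ (n + 1) := by
    rw [seqScale_qQuotient hq1 ξ.ne_zero]
    congr 1
    ext n
    simp [ha, qCoeff]
  have hkill : aeval (seqShift K) (∏ i, (X - C (α i : K)))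
      (fun n => (1 - (q : K)) * ∑ i, β i * (α i : K) ^ (n + 1)) = 0 := by
    have e : (fun n => (1 - (q : K)) * ∑ i, β i * (α i : K) ^ (n + 1)) =
        ∑ i, fun n : ℕ => ((1 - (q : K)) * (β i * α i)) * (α i : K) ^ n := by
      ext n
      rw [Finset.sum_apply, Finset.mul_sum]
      exact Finset.sum_congr rfl fun i _ => by ring
    rw [e, map_sum]
    refine Finset.sum_eq_zero fun i _ => ?_
    rw [aeval_seqShift_geom, eval_prod, Finset.prod_eq_zero (Finset.mem_univ i) (by simp)]
    ext n
    simp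
  obtain ⟨N, hN⟩ := exists_qIterate_eventually_eq_zero q.ne_zero hq hrec hkill
    (fun w => hgrowth w.1 (Or.inl w.isInfinitePlace))
    (fun w => hgrowth w.1 (Or.inr w.isFinitePlace))
    (finite_not_forall_qQuotient_le_one hq1 ξ.ne_zero _ _ _)
  have hres := exists_resonance q.ne_zero hq1 (fun i => (α i).ne_zero)
    (injective_div_pow_of_injective_mk hq1 hα) hrec hN
  have hterm : ∀ v : AbsoluteValue K ℝ, IsPlace v → 1 < v (q : K) → ∀ i,
      toCompletion v (β i) * qExp (toCompletion v (q : K))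
        (toCompletion v (α i : K) * toCompletion v (ξ : K)) = 0 := by
    intro v _ h1 i
    by_cases hβ : β i = 0
    · rw [hβ, map_zero, zero_mul]
    · obtain ⟨k, hk⟩ := hres i hβ
      rw [qExp_eq_zero (by rwa [norm_toCompletion]) k, mul_zero]
      have := congr_arg (toCompletion v) hk
      rw [map_mul, map_mul, map_sub, map_one, map_pow] at this
      rw [← this]
      ring
  refine ⟨?_, hterm⟩
  obtain ⟨v, hv, h1⟩ : ∃ v : AbsoluteValue K ℝ, IsPlace v ∧ 1 < v (q : K) := by
    rcases exists_place_one_lt q.ne_zero hq with ⟨w, hw⟩ | ⟨w, hw⟩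
    · exact ⟨w.1, Or.inl w.isInfinitePlace, hw⟩
    · exact ⟨w.1, Or.inr w.isFinitePlace, hw⟩
  have h0 := hvanish v hv h1
  rw [qExpSum, Finset.sum_eq_zero fun i _ => hterm v hv h1 i, add_zero] at h0
  exact (map_eq_zero _).mp h0
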